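/- Let $d\ge 3$, let $\mathbb T_d$ be the $d$-regular tree with a distinguished vertex $\rho$, and let $\mathbb T_d\times\mathbb Z$ be the Cartesian product of $\mathbb T_d$ with the integer line (two vertices are adjacent if they agree in one coordinate and are adjacent in the other). Let $(X_e)$, indexed by the edges $e$ of $\mathbb T_d\times\mathbb Z$, be independent copies of a random variable $X\ge 0$. For a path $\gamma$ write $|\gamma|$ for its number of edges and $|\gamma|_X=\sum_{e\in\gamma}X_e$, and for $n\ge 0$ let $$D(n)=\inf\{|\gamma|_X : \gamma \text{ a path from } (\rho,0) \text{ to } (\rho,n) \text{ in } \mathbb T_d\times\mathbb Z\}.$$ Assume the following hypothesis (H): 1. $\mathbb E[X^{1+\varepsilon}]<\infty$ for some $\varepsilon>0$; 2. there is a constant $K<\infty$ such that for every $n\ge 1$ there is a random path $\gamma_n$ from $(\rho,0)$ to $(\rho,n)$ that almost surely satisfies $|\gamma_n|_X=D(n)$ (the infimum is attained), with $\mathbb E[|\gamma_n|]<Kn^K$. Then each $D(n)$ is an integrable random variable, and the sequence $$\frac{D(n)-\mathbb E[D(n)]}{\log n},\qquad n\ge 2,$$ is tight. Moreover, there is a constant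 $C<\infty$ such that $\mathbb E\,\big|D(n)-\mathbb E[D(n)]\big|\le C\log n$ for all $n\ge 2$. -/

import Mathlib

open MeasureTheory ProbabilityTheory
open scoped ENNReal

noncomputable section

/-- The Cartesian product `T × ℤ` of a graph `T` with the integer line: `(u, i)` and `(v, j)` are
adjacent iff either `u`, `v` are adjacent in `T` and `i = j`, or `u = v` and `|i - j| = 1`. -/
abbrev prodZ {V : Type*} (T : SimpleGraph V) : SimpleGraph (V × ℤ) :=
  T □ SimpleGraph.hasse ℤ

/-- The weight `|γ|_x = ∑_{e ∈ γ} x e` of a path `γ`, for edge weights `x`. Paths are walks here, and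
an edge is counted each time it is traversed. -/
def pathWeight {W : Type*} {G : SimpleGraph W} (x : G.edgeSet → ℝ) {v w : W} (γ : G.Walk v w) : ℝ :=
  (γ.darts.map fun a => x ⟨a.edge, a.edge_mem⟩).sum

/-- The first passage distance `d_x(v, w) = inf {|γ|_x : γ a path from v to w}`. -/
def passageTime {W : Type*} {G : SimpleGraph W} (x : G.edgeSet → ℝ) (v w : W) : ℝ :=
  ⨅ γ : G.Walk v w, pathWeight x γ

/-- `γ` has minimal weight among all paths with the same end points. -/
def IsMinimizing {W : Type*} {G : SimpleGraph W} (x : G.edgeSet → ℝ) {v w : W} (γ : G.Walk v w) :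
    Prop :=
  ∀ γ' : G.Walk v w, pathWeight x γ ≤ pathWeight x γ'

/-- The random variable `D(n) = d_X((ρ, 0), (ρ, n))`. -/
def verticalTime {V Ω : Type*} {T : SimpleGraph V} (X : (prodZ T).edgeSet → Ω → ℝ) (ρ : V)
    (n : ℕ) (ω : Ω) : ℝ :=
  passageTime (fun e => X e ω) (ρ, (0 : ℤ)) (ρ, (n : ℤ))

/-- The edge weights `X e`, for `e` an edge of `G`, are independent copies of one nonnegative
random variable. -/
structure IsIIDWeights {W Ω : Type*} [MeasurableSpace Ω] {G : SimpleGraph W}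
    (X : G.edgeSet → Ω → ℝ) (P : Measure Ω) : Prop where
  nonneg : ∀ e ω, 0 ≤ X e ω
  measurable : ∀ e, Measurable (X e)
  identDistrib : ∀ e f, IdentDistrib (X e) (X f) P P
  indep : iIndepFun X P

/-- Hypothesis (H): a moment of order `1 + ε` of the weights, and a polynomial bound, for all
`n ≥ 1`, on the expected number of edges of a (random) path `γ n` that almost surely minimizes
`D(n)`. Minimizing paths need not be unique: any choice of them is allowed. -/
structure HypothesisH {V Ω : Type*} [MeasurableSpace Ω] {T : SimpleGraph V}
    (X : (prodZ T).edgeSet → Ω → ℝ) (ρ : V) (P : Measure Ω) : Prop where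
  moment : ∃ ε : ℝ, 0 < ε ∧ ∀ e, Integrable (fun ω => X e ω ^ (1 + ε)) P
  minimizer : ∃ K : ℝ, ∃ γ : (n : ℕ) → Ω → (prodZ T).Walk (ρ, (0 : ℤ)) (ρ, (n : ℤ)),
    ∀ n : ℕ, 1 ≤ n →
      (∀ᵐ ω ∂P, IsMinimizing (fun e => X e ω) (γ n ω)) ∧
      ∫⁻ ω, ((γ n ω).length : ℝ≥0∞) ∂P < ENNReal.ofReal (K * (n : ℝ) ^ K)

end

/-! ### Geometry of regular trees: separation by an edge, reflection across an edge, growth of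
spheres. -/

namespace SimpleGraph

variable {V : Type*} {T : SimpleGraph V}

/-! Deleting a tree edge `uw` splits `T × ℤ` into two mirror halves carrying independent weights.
Let `A` be the passage time confined to the half over `u`, which contains `ρ`, and `B` its mirror
image over `w`: an independent copy of `A`.

If `u` is at depth `l`, a detour from `ρ` to its mirror image and back costs `O(l)` on average, so
`E D ≤ E min(A, B) + O(l)`. Conversely, `A = D` whenever a minimizing path avoids the fibre over
`w`. There are at least `2 ^ (l + 1)` candidates for `w` and a minimizer has polynomially many edges
on average, so for some `w` the fibre is hit with probability at most a power of `n` times `2 ^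
(-l)` (`exists_edge_sideTime`). With `l` of order `log n` and the `1 + ε` moment, `E A ≤ E D +
O(1)`.

Hence `E A - E min(A, B) = O(log n)`. For independent copies this is half of `E |A - B|`, which
dominates `E |A - E A|`. As `A ≥ D` are close in mean, `D` inherits the bound, and Markov's
inequality gives tightness. -/

theorem IsTree.eq_of_adj_of_dist_eq_add_one (hT : T.IsTree) {r x y z : V} (hy : T.Adj y x)
    (hz : T.Adj z x) (hdy : T.dist r x = T.dist r y + 1) (hdz : T.dist r x = T.dist r z + 1) :
    y = z := by
  obtain ⟨p, hp⟩ := hT.connected.exists_walk_length_eq_dist r y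
  obtain ⟨q, hq⟩ := hT.connected.exists_walk_length_eq_dist r z
  have hp' : (p.concat hy).IsPath := Walk.isPath_of_length_eq_dist _ (by simp [hp, hdy])
  have hq' : (q.concat hz).IsPath := Walk.isPath_of_length_eq_dist _ (by simp [hq, hdz])
  have h : p.concat hy = q.concat hz :=
    congrArg Subtype.val ((hT.isAcyclic.subsingleton_path _ _).elim ⟨_, hp'⟩ ⟨_, hq'⟩)
  have := congrArg Walk.penultimate h
  simpa using this

theorem Connected.exists_adj_dist_eq_add_one (hT : T.Connected) {r x : V} (hx : x ≠ r) :
    ∃ y, T.Adj y x ∧ T.dist r x = T.dist r y + 1 := by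
  obtain ⟨p, hp⟩ := hT.exists_walk_length_eq_dist x r
  cases p with
  | nil => exact absurd rfl hx
  | @cons _ y _ h p =>
    refine ⟨y, h.symm, ?_⟩
    have h1 := T.dist_le p
    have h2 := hT.dist_triangle (u := x) (v := y) (w := r)
    rw [dist_eq_one_iff_adj.2 h] at h2
    rw [Walk.length_cons] at hp
    rw [dist_comm (u := r) (v := x), dist_comm (u := r) (v := y)]
    omega

/-- The half nearer to `w` can only be entered at `w`: otherwise the neighbour of `y` towards `w`
would also be its neighbour towards `u`, namely `x`, which is farther from `w` than `y`. -/
theorem IsTree.dist_cross (hT : T.IsTree) {u w x y : V} (huw : T.Adj u w) (hxy : T.Adj x y)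
    (hx : T.dist u x < T.dist w x) (hy : ¬ T.dist u y < T.dist w y) : y = w := by
  have a1 := hT.dist_eq_dist_add_one_of_adj u hxy
  have a2 := hT.dist_eq_dist_add_one_of_adj w hxy
  have a3 := hT.dist_eq_dist_add_one_of_adj x huw
  have a4 := hT.dist_eq_dist_add_one_of_adj y huw
  rw [dist_comm (u := x) (v := u), dist_comm (u := x) (v := w)] at a3
  rw [dist_comm (u := y) (v := u), dist_comm (u := y) (v := w)] at a4
  by_contra hne
  obtain ⟨z, hz, hdz⟩ := hT.connected.exists_adj_dist_eq_add_one hne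
  have : z = x := by
    refine hT.eq_of_adj_of_dist_eq_add_one (r := u) hz hxy ?_ (by omega)
    have h2 := hT.dist_eq_dist_add_one_of_adj u hz
    have h3 := hT.dist_eq_dist_add_one_of_adj z huw
    rw [dist_comm (u := z) (v := u), dist_comm (u := z) (v := w)] at h3
    omega
  subst this
  omega

/-- By regularity, the two rooted halves left by deleting `uw` have the same branching; matching
children by number gives the reflection. -/
theorem IsTree.exists_iso_swap [T.LocallyFinite] (hT : T.IsTree) {d : ℕ}
    (hreg : T.IsRegularOfDegree d) {u w : V} (huw : T.Adj u w) :
    ∃ φ : T ≃g T, φ u = w ∧ φ w = u := by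
  classical
  -- Parents point towards the edge `uw`, whose ends are parents of each other. So every vertex, `u`
  -- included, has exactly `d - 1` children.
  have hpar : ∀ x, ∃ y, T.Adj y x ∧ (x = u → y = w) ∧ (x ≠ u → T.dist u x = T.dist u y + 1) := by
    intro x
    by_cases hx : x = u
    · subst hx
      exact ⟨w, huw.symm, fun _ => rfl, fun h => absurd rfl h⟩
    · obtain ⟨y, h1, h2⟩ := hT.connected.exists_adj_dist_eq_add_one hx
      exact ⟨y, h1, fun h => absurd h hx, fun _ => h2⟩
  choose par par_adj par_u par_dist using hpar
  have par_u : par u = w := par_u u rfl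
  have adj_par : ∀ x y, T.Adj x y → T.dist u y = T.dist u x + 1 → x = par y := by
    intro x y h hd
    have hy : y ≠ u := by rintro rfl; simp at hd
    exact hT.eq_of_adj_of_dist_eq_add_one h (par_adj y) hd (par_dist y hy)
  have par_w : par w = u := by
    refine (adj_par u w huw ?_).symm
    simpa using huw
  have edge : ∀ x y, T.Adj x y → x = par y ∨ y = par x := by
    intro x y h
    rcases hT.dist_eq_dist_add_one_of_adj u h with h' | h'
    · exact Or.inr (adj_par y x h.symm h')
    · exact Or.inl (adj_par x y h h')
  have hcode : ∀ p, ∃ (f : V → ℕ) (g : ℕ → V),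
      (∀ q, T.Adj p q → q ≠ par p → f q < d - 1 ∧ g (f q) = q) ∧
      (∀ i < d - 1, T.Adj p (g i) ∧ g i ≠ par p ∧ f (g i) = i) := by
    intro p
    have hc : ((T.neighborFinset p).erase (par p)).card = d - 1 := by
      rw [Finset.card_erase_of_mem (by simpa using (par_adj p).symm), card_neighborFinset_eq_degree,
        hreg p]
    let e := Finset.equivFinOfCardEq hc
    refine ⟨fun q => if h : q ∈ (T.neighborFinset p).erase (par p) then e ⟨q, h⟩ else 0,
      fun i => if h : i < d - 1 then e.symm ⟨i, h⟩ else p, ?_, ?_⟩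
    · intro q h1 h2
      have hq : q ∈ (T.neighborFinset p).erase (par p) := by simp [h1, h2]
      simp only [dif_pos hq]
      exact ⟨(e ⟨q, hq⟩).2, by simp⟩
    · intro i hi
      have h := (e.symm ⟨i, hi⟩).2
      have h' := h
      rw [Finset.mem_erase, mem_neighborFinset] at h'
      simp only [dif_pos hi]
      refine ⟨h'.2, h'.1, ?_⟩
      rw [dif_pos h]
      simp
  choose f g hf hg using hcode
  -- Recursion on the distance to `u`: the `i`-th child of `p` goes to the `i`-th child of `ψ p`.
  obtain ⟨ψ, hψ⟩ : ∃ ψ : V → V, ∀ x, ψ x = if x = u then w else if x = w then u else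
      g (ψ (par x)) (f (par x) x) := by
    let F : (x : V) → ((y : V) → T.dist u y < T.dist u x → V) → V := fun x r =>
      if hx : x = u then w else if x = w then u else
        g (r (par x) (by have := par_dist x hx; omega)) (f (par x) x)
    refine ⟨(measure fun x => T.dist u x).wf.fix F, fun x => ?_⟩
    rw [WellFounded.fix_eq]
    by_cases hx : x = u <;> simp [F, hx]
  have ψu : ψ u = w := by rw [hψ]; simp
  have ψw : ψ w = u := by rw [hψ]; simp [huw.ne']
  have step : ∀ x, x ≠ u → x ≠ w → ψ x = g (ψ (par x)) (f (par x) x) ∧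
      f (par x) x < d - 1 ∧ g (par x) (f (par x) x) = x := by
    intro x hu hw
    refine ⟨by rw [hψ]; simp [hu, hw], hf (par x) x (par_adj x) ?_⟩
    intro h
    by_cases hp : par x = u
    · rw [hp, par_u] at h; exact hw h
    · have h1 := par_dist x hu
      have h2 := par_dist _ hp
      rw [← h] at h2
      omega
  have par_ψ : ∀ x, ψ (par x) = par (ψ x) := by
    intro x
    by_cases hu : x = u
    · rw [hu, par_u, ψw, ψu, par_w]
    by_cases hw : x = w
    · rw [hw, par_w, ψw, ψu, par_u]
    obtain ⟨h1, h2, h3⟩ := step x hu hw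
    obtain ⟨h4, h5, h6⟩ := hg (ψ (par x)) _ h2
    rw [← h1] at h4 h5
    exact (edge _ _ h4).resolve_right h5
  have inv : ∀ n x, T.dist u x = n → ψ (ψ x) = x := by
    intro n
    induction n with
    | zero =>
      intro x hx
      have : u = x := hT.connected.dist_eq_zero_iff.1 hx
      rw [← this, ψu, ψw]
    | succ n ih =>
      intro x hx
      have hu : x ≠ u := by rintro rfl; simp at hx
      by_cases hw : x = w
      · rw [hw, ψw, ψu]
      obtain ⟨h1, h2, h3⟩ := step x hu hw
      obtain ⟨h4, h5, h6⟩ := hg (ψ (par x)) _ h2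
      rw [← h1] at h4 h5 h6
      have hpp := par_ψ x
      have hyu : ψ x ≠ u := by
        intro h
        rw [hpp, h, par_u, par_w] at h5
        exact h5 rfl
      have hyw : ψ x ≠ w := by
        intro h
        rw [hpp, h, par_w, par_u] at h5
        exact h5 rfl
      rw [(step _ hyu hyw).1, ← hpp, h6, ih (par x) (by have := par_dist x hu; omega), h3]
  have inv' : ∀ x, ψ (ψ x) = x := fun x => inv _ x rfl
  have adj : ∀ x y, T.Adj x y → T.Adj (ψ x) (ψ y) := by
    intro x y h
    rcases edge x y h with h' | h'
    · rw [h', par_ψ]; exact par_adj _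
    · rw [h', par_ψ]; exact (par_adj _).symm
  refine ⟨⟨⟨ψ, ψ, inv', inv'⟩, ?_⟩, ψu, ψw⟩
  intro x y
  refine ⟨fun h => ?_, adj x y⟩
  have := adj _ _ h
  simpa [inv'] using this

theorem Iso.dist_eq (φ : T ≃g T) (x y : V) : T.dist (φ x) (φ y) = T.dist x y := by
  have key : ∀ (φ : T ≃g T) (x y : V), T.edist (φ x) (φ y) ≤ T.edist x y := by
    intro φ x y
    rw [T.edist_eq_sInf (u := x)]
    refine le_sInf ?_
    rintro _ ⟨p, rfl⟩
    simpa using edist_le (p.map φ.toHom)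
  have h := key φ.symm (φ x) (φ y)
  simp only [RelIso.symm_apply_apply] at h
  rw [dist, dist, le_antisymm (key φ x y) h]

/-- At most one of the `d ≥ 3` neighbours of a vertex is nearer to `r`, so spheres at least double.
-/
theorem IsTree.exists_finset_dist_eq [T.LocallyFinite] (hT : T.IsTree) {d : ℕ} (hd : 3 ≤ d)
    (hreg : T.IsRegularOfDegree d) (r : V) (l : ℕ) :
    ∃ S : Finset V, 2 ^ l ≤ S.card ∧ ∀ x ∈ S, T.dist r x = l := by
  classical
  induction l with
  | zero => exact ⟨{r}, by simp, by simp⟩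
  | succ l ih =>
    obtain ⟨S, hS, hSd⟩ := ih
    let N : V → Finset V := fun p => (T.neighborFinset p).filter fun q => T.dist r q = l + 1
    refine ⟨S.biUnion N, ?_, ?_⟩
    · rw [Finset.card_biUnion]
      · have : ∀ p ∈ S, 2 ≤ (N p).card := by
          intro p hp
          have h1 := Finset.card_filter_add_card_filter_not (s := T.neighborFinset p)
            (fun q => T.dist r q = l + 1)
          rw [card_neighborFinset_eq_degree, hreg p] at h1
          have h2 : ((T.neighborFinset p).filter fun q => ¬ T.dist r q = l + 1).card ≤ 1 := by
            refine Finset.card_le_one.2 fun a ha b hb => ?_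
            simp only [Finset.mem_filter, mem_neighborFinset] at ha hb
            have ha' := hT.dist_eq_dist_add_one_of_adj r ha.1
            have hb' := hT.dist_eq_dist_add_one_of_adj r hb.1
            rw [hSd p hp] at ha' hb'
            refine hT.eq_of_adj_of_dist_eq_add_one (r := r) ha.1.symm hb.1.symm ?_ ?_ <;>
            rw [hSd p hp] <;> omega
          have : (N p).card = ((T.neighborFinset p).filter fun q => T.dist r q = l + 1).card := rfl
          omega
        calc 2 ^ (l + 1) ≤ S.card * 2 := by rw [pow_succ]; gcongr
          _ = ∑ p ∈ S, 2 := by simp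
          _ ≤ _ := Finset.sum_le_sum this
      · intro a ha b hb hab
        rw [Function.onFun, Finset.disjoint_left]
        intro q hqa hqb
        simp only [N, Finset.mem_filter, mem_neighborFinset] at hqa hqb
        exact hab (hT.eq_of_adj_of_dist_eq_add_one (r := r) hqa.1 hqb.1
          (by rw [hSd a ha, hqa.2]) (by rw [hSd b hb, hqb.2]))
    · intro x hx
      simp only [N, Finset.mem_biUnion, Finset.mem_filter] at hx
      obtain ⟨_, _, _, h⟩ := hx
      exact h

theorem Connected.countable_of_locallyFinite [T.LocallyFinite] (hT : T.Connected) :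
    Countable V := by
  classical
  obtain ⟨r⟩ := hT.nonempty
  have hfin : ∀ n, {x | T.dist r x = n}.Finite := by
    intro n
    induction n with
    | zero =>
      refine (Set.finite_singleton r).subset fun x hx => ?_
      exact (hT.dist_eq_zero_iff.1 hx).symm
    | succ n ih =>
      refine (ih.biUnion fun p _ => (T.neighborFinset p).finite_toSet).subset fun x hx => ?_
      have hxr : x ≠ r := by rintro rfl; simp at hx
      obtain ⟨y, h1, h2⟩ := hT.exists_adj_dist_eq_add_one hxr
      simp only [Set.mem_ofPred_eq, Set.mem_iUnion] at hx ⊢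
      exact ⟨y, by omega, by simpa using h1⟩
  rw [← Set.countable_univ_iff]
  refine (Set.countable_iUnion fun n => (hfin n).countable).mono fun x _ => ?_
  simp

instance Walk.countable {W : Type*} [Countable W] {G : SimpleGraph W} (a b : W) :
    Countable (G.Walk a b) :=
  Function.Injective.countable (f := fun p : G.Walk a b => p.support)
    fun _ _ h => Walk.ext_support h

end SimpleGraph

/-! ### Path weights and restricted passage times. -/

section PathWeight

variable {W : Type*} {G : SimpleGraph W}

@[simp] theorem pathWeight_nil (x : G.edgeSet → ℝ) (a : W) :
    pathWeight x (SimpleGraph.Walk.nil : G.Walk a a) = 0 := rfl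

@[simp] theorem pathWeight_cons (x : G.edgeSet → ℝ) {a b c : W} (h : G.Adj a b) (γ : G.Walk b c) :
    pathWeight x (γ.cons h) = x ⟨s(a, b), h⟩ + pathWeight x γ := rfl

theorem pathWeight_append (x : G.edgeSet → ℝ) {a b c : W} (γ : G.Walk a b) (γ' : G.Walk b c) :
    pathWeight x (γ.append γ') = pathWeight x γ + pathWeight x γ' := by
  simp [pathWeight]

theorem pathWeight_nonneg {x : G.edgeSet → ℝ} (hx : ∀ e, 0 ≤ x e) {a b : W} (γ : G.Walk a b) :
    0 ≤ pathWeight x γ := by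
  induction γ with
  | nil => simp
  | cons h γ ih => rw [pathWeight_cons]; exact add_nonneg (hx _) ih

theorem pathWeight_map {W' : Type*} {G' : SimpleGraph W'} (f : G →g G') (x : G'.edgeSet → ℝ)
    {a b : W} (γ : G.Walk a b) :
    pathWeight x (γ.map f) = pathWeight (fun e => x (f.mapEdgeSet e)) γ := by
  induction γ with
  | nil => rfl
  | cons h γ ih => rw [SimpleGraph.Walk.map_cons, pathWeight_cons, pathWeight_cons, ih]; rfl

theorem bddBelow_pathWeight {ι : Sort*} {x : G.edgeSet → ℝ} (hx : ∀ e, 0 ≤ x e) {a b : W}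
    (γ : ι → G.Walk a b) : BddBelow (Set.range fun i => pathWeight x (γ i)) :=
  ⟨0, by rintro _ ⟨i, rfl⟩; exact pathWeight_nonneg hx _⟩

theorem passageTime_le {x : G.edgeSet → ℝ} (hx : ∀ e, 0 ≤ x e) {a b : W} (γ : G.Walk a b) :
    passageTime x a b ≤ pathWeight x γ :=
  ciInf_le (bddBelow_pathWeight hx id) γ

/-- The first passage distance over the paths that stay inside `S`. -/
noncomputable def restrictedTime (x : G.edgeSet → ℝ) (S : Set W) (a b : W) : ℝ :=
  ⨅ γ : {γ : G.Walk a b // ∀ v ∈ γ.support, v ∈ S}, pathWeight x γ.1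

theorem restrictedTime_le {x : G.edgeSet → ℝ} (hx : ∀ e, 0 ≤ x e) {S : Set W} {a b : W}
    (γ : G.Walk a b) (hγ : ∀ v ∈ γ.support, v ∈ S) : restrictedTime x S a b ≤ pathWeight x γ :=
  ciInf_le (bddBelow_pathWeight hx fun γ : {γ : G.Walk a b // ∀ v ∈ γ.support, v ∈ S} => γ.1)
    ⟨γ, hγ⟩

theorem passageTime_nonneg {x : G.edgeSet → ℝ} (hx : ∀ e, 0 ≤ x e) (a b : W) :
    0 ≤ passageTime x a b :=
  Real.iInf_nonneg fun _ => pathWeight_nonneg hx _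

theorem restrictedTime_nonneg {x : G.edgeSet → ℝ} (hx : ∀ e, 0 ≤ x e) (S : Set W) (a b : W) :
    0 ≤ restrictedTime x S a b :=
  Real.iInf_nonneg fun _ => pathWeight_nonneg hx _

theorem passageTime_le_restrictedTime {x : G.edgeSet → ℝ} (hx : ∀ e, 0 ≤ x e) {S : Set W} {a b : W}
    (γ : G.Walk a b) (hγ : ∀ v ∈ γ.support, v ∈ S) :
    passageTime x a b ≤ restrictedTime x S a b := by
  have : Nonempty {γ : G.Walk a b // ∀ v ∈ γ.support, v ∈ S} := ⟨⟨γ, hγ⟩⟩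
  exact le_ciInf fun γ' => passageTime_le hx _

/-- A detour of weight `h` to the image of `S` under `f`. -/
theorem passageTime_le_restrictedTime_comp_add {x : G.edgeSet → ℝ} (hx : ∀ e, 0 ≤ x e) (f : G →g G)
    {S : Set W} {a b : W} (γ : G.Walk a b) (hγ : ∀ v ∈ γ.support, v ∈ S)
    (α : G.Walk a (f a)) (β : G.Walk (f b) b) :
    passageTime x a b ≤ restrictedTime (fun e => x (f.mapEdgeSet e)) S a b +
      (pathWeight x α + pathWeight x β) := by
  have : Nonempty {γ : G.Walk a b // ∀ v ∈ γ.support, v ∈ S} := ⟨⟨γ, hγ⟩⟩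
  rw [← sub_le_iff_le_add]
  refine le_ciInf fun γ' => ?_
  have h := passageTime_le hx (α.append ((γ'.1.map f).append β))
  rw [pathWeight_append, pathWeight_append, pathWeight_map] at h
  linarith

theorem measurable_pathWeight {Ω : Type*} {m : MeasurableSpace Ω} {X : G.edgeSet → Ω → ℝ}
    {a b : W} (γ : G.Walk a b) (h : ∀ e : G.edgeSet, e.1 ∈ γ.edges → Measurable[m] (X e)) :
    Measurable[m] fun ω => pathWeight (fun e => X e ω) γ := by
  induction γ with
  | nil => simp only [pathWeight_nil]; exact measurable_const
  | cons hab γ ih =>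
    simp only [pathWeight_cons]
    exact (h ⟨s(_, _), hab⟩ (by simp)).add (ih fun e he => h e (by simp [he]))

theorem measurable_restrictedTime [Countable W] {Ω : Type*} {m : MeasurableSpace Ω}
    {X : G.edgeSet → Ω → ℝ} {S : Set W} (h : ∀ e : G.edgeSet, (∀ v ∈ e.1, v ∈ S) → Measurable[m] (X e))
    (a b : W) : Measurable[m] fun ω => restrictedTime (fun e => X e ω) S a b :=
  Measurable.iInf fun γ => measurable_pathWeight γ.1 fun e he => h e fun _ hv =>
    γ.2 _ (SimpleGraph.Walk.mem_support_of_mem_edges he hv)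

theorem measurable_passageTime [Countable W] {Ω : Type*} {m : MeasurableSpace Ω}
    {X : G.edgeSet → Ω → ℝ} (h : ∀ e : G.edgeSet, Measurable[m] (X e))
    (a b : W) : Measurable[m] fun ω => passageTime (fun e => X e ω) a b :=
  Measurable.iInf fun γ => measurable_pathWeight γ fun e _ => h e

theorem integrable_pathWeight {Ω : Type*} [MeasurableSpace Ω] {P : Measure Ω}
    {X : G.edgeSet → Ω → ℝ} (h : ∀ e, Integrable (X e) P) {a b : W} (γ : G.Walk a b) :
    Integrable (fun ω => pathWeight (fun e => X e ω) γ) P := by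
  induction γ with
  | nil => simp
  | cons hab γ ih => simp only [pathWeight_cons]; exact (h _).add ih

theorem setIntegral_pathWeight_le {Ω : Type*} [MeasurableSpace Ω] {P : Measure Ω}
    {X : G.edgeSet → Ω → ℝ} (h : ∀ e, Integrable (X e) P) {s : Set Ω} {c : ℝ}
    (hc : ∀ e, ∫ ω in s, X e ω ∂P ≤ c) {a b : W} (γ : G.Walk a b) :
    ∫ ω in s, pathWeight (fun e => X e ω) γ ∂P ≤ γ.length * c := by
  induction γ with
  | nil => simp
  | cons hab γ ih =>
    simp only [pathWeight_cons, SimpleGraph.Walk.length_cons]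
    rw [integral_add (h _).integrableOn (integrable_pathWeight h γ).integrableOn]
    push_cast
    have := hc ⟨s(_, _), hab⟩
    linarith

end PathWeight

/-! ### Walks and automorphisms of the product with the line. -/

section Product

variable {V : Type*} {T : SimpleGraph V}

theorem exists_vertical_walk (T : SimpleGraph V) (ρ : V) (n : ℕ) :
    ∃ γ : (prodZ T).Walk (ρ, (0 : ℤ)) (ρ, (n : ℤ)), γ.length = n ∧ ∀ v ∈ γ.support, v.1 = ρ := by
  induction n with
  | zero => exact ⟨SimpleGraph.Walk.nil, rfl, by simp⟩
  | succ n ih =>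
    obtain ⟨γ, h1, h2⟩ := ih
    have hadj : (prodZ T).Adj (ρ, (n : ℤ)) (ρ, ((n + 1 : ℕ) : ℤ)) := by
      rw [SimpleGraph.boxProd_adj_right, SimpleGraph.hasse_adj]
      left
      push_cast
      exact Order.covBy_add_one _
    refine ⟨γ.concat hadj, by simp [h1], fun v hv => ?_⟩
    rw [SimpleGraph.Walk.support_concat, List.mem_append] at hv
    rcases hv with hv | hv
    · exact h2 v hv
    · rw [List.mem_singleton.1 hv]

theorem SimpleGraph.Connected.exists_horizontal_walk (hT : T.Connected) (u v : V) (i : ℤ) :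
    ∃ γ : (prodZ T).Walk (u, i) (v, i), γ.length = T.dist u v := by
  obtain ⟨p, hp⟩ := hT.exists_walk_length_eq_dist u v
  exact ⟨p.map (SimpleGraph.boxProdLeft T (SimpleGraph.hasse ℤ) i).toHom,
    (SimpleGraph.Walk.length_map _ _).trans hp⟩

/-- The automorphism of `T × ℤ` that acts as `φ` on `T`. -/
def SimpleGraph.Iso.prodZ (φ : T ≃g T) : prodZ T ≃g prodZ T where
  toEquiv := φ.toEquiv.prodCongr (Equiv.refl ℤ)
  map_rel_iff' := by
    intro a b
    have h : T.Adj (φ a.1) (φ b.1) ↔ T.Adj a.1 b.1 := φ.map_adj_iff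
    simp [SimpleGraph.boxProd_adj, h]

theorem SimpleGraph.IsTree.walk_mem_side (hT : T.IsTree) {u w : V} (huw : T.Adj u w)
    {a b : V × ℤ} (γ : (_root_.prodZ T).Walk a b) (ha : T.dist u a.1 < T.dist w a.1)
    (h : ∀ v ∈ γ.support, v.1 ≠ w) : ∀ v ∈ γ.support, T.dist u v.1 < T.dist w v.1 := by
  induction γ with
  | nil => simpa using ha
  | @cons a b c hab γ ih =>
    have hb : T.dist u b.1 < T.dist w b.1 := by
      rcases SimpleGraph.boxProd_adj.1 hab with h' | h'
      · by_contra hcon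
        exact h b (by simp) (hT.dist_cross huw h'.1 ha hcon)
      · rwa [← h'.2]
    intro v hv
    rw [SimpleGraph.Walk.support_cons, List.mem_cons] at hv
    rcases hv with rfl | hv
    · exact ha
    · exact ih hb (fun v hv => h v (by simp [hv])) v hv

end Product

/-! ### Independence, fluctuations and moment bounds. -/

section Probability

variable {Ω : Type*} [MeasurableSpace Ω] {P : Measure Ω}

theorem ProbabilityTheory.iIndepFun.indepFun_of_measurable_iSup {ι : Type*} {X : ι → Ω → ℝ}
    (hX : iIndepFun X P) (hm : ∀ i, Measurable (X i)) {S S' : Set ι} (hS : Disjoint S S')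
    {A B : Ω → ℝ}
    (hA : Measurable[⨆ i ∈ S, MeasurableSpace.comap (X i) inferInstance] A)
    (hB : Measurable[⨆ i ∈ S', MeasurableSpace.comap (X i) inferInstance] B) :
    IndepFun A B P := by
  rw [IndepFun_iff_Indep]
  exact indep_of_indep_of_le_left (indep_of_indep_of_le_right
    (indep_iSup_of_disjoint (fun i => (hm i).comap_le) hX.iIndep hS) hB.comap_le) hA.comap_le

theorem identDistrib_precomp_of_iIndepFun [IsProbabilityMeasure P] {ι : Type*} {X : ι → Ω → ℝ}
    (hX : iIndepFun X P) (hm : ∀ i, Measurable (X i)) (hid : ∀ i j, IdentDistrib (X i) (X j) P P)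
    {f : ι → ι} (hf : f.Injective) :
    IdentDistrib (fun ω i => X i ω) (fun ω i => X (f i) ω) P P where
  aemeasurable_fst := (measurable_pi_lambda _ hm).aemeasurable
  aemeasurable_snd := (measurable_pi_lambda _ fun i => hm (f i)).aemeasurable
  map_eq := by
    rw [(iIndepFun_iff_map_fun_eq_infinitePi_map (by fun_prop)).1 hX,
      (iIndepFun_iff_map_fun_eq_infinitePi_map (by fun_prop)).1 (hX.precomp hf)]
    congr
    funext i
    exact (hid i (f i)).map_eq

/-- The right side is `E |A - B|`, since `|a - b| = a + b - 2 min(a, b)`; averaging over `B` inside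
the absolute value only decreases it. -/
theorem integral_abs_sub_integral_le_of_indepFun [IsProbabilityMeasure P] {A B : Ω → ℝ}
    (hA : Integrable A P) (hind : IndepFun A B P) (hid : IdentDistrib A B P P) :
    ∫ ω, |A ω - ∫ ω', A ω' ∂P| ∂P ≤ 2 * (∫ ω, A ω ∂P - ∫ ω, min (A ω) (B ω) ∂P) := by
  have hB : Integrable B P := hid.integrable_iff.1 hA
  have hAm := hid.aemeasurable_fst
  have hBm := hid.aemeasurable_snd
  have hprod := (indepFun_iff_map_prod_eq_prod_map_map hAm hBm).1 hind
  have hpA : IsProbabilityMeasure (P.map A) := Measure.isProbabilityMeasure_map hAm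
  have hpB : IsProbabilityMeasure (P.map B) := Measure.isProbabilityMeasure_map hBm
  have habs : ∫ ω, |A ω - B ω| ∂P = 2 * (∫ ω, A ω ∂P - ∫ ω, min (A ω) (B ω) ∂P) := by
    have h : ∀ ω, |A ω - B ω| = A ω + B ω - 2 * min (A ω) (B ω) := by
      intro ω
      rcases le_total (A ω) (B ω) with h | h
      · rw [min_eq_left h, abs_of_nonpos (by linarith)]; ring
      · rw [min_eq_right h, abs_of_nonneg (by linarith)]; ring
    simp_rw [h]
    have hmin : Integrable (fun ω => 2 * min (A ω) (B ω)) P := (hA.inf hB).const_mul 2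
    have hadd : Integrable (fun ω => A ω + B ω) P := hA.add hB
    rw [integral_sub hadd hmin, integral_add hA hB, integral_const_mul, ← hid.integral_eq]
    ring
  have hint : Integrable (fun p : ℝ × ℝ => |p.1 - p.2|) ((P.map A).prod (P.map B)) := by
    rw [← hprod, integrable_map_measure (by fun_prop) (by fun_prop)]
    exact (hA.sub hB).abs
  have hidA : Integrable (fun x : ℝ => x) (P.map A) := by
    rw [integrable_map_measure (by fun_prop) hAm]
    exact hA
  have hidB : Integrable (fun x : ℝ => x) (P.map B) := by
    rw [integrable_map_measure (by fun_prop) hBm]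
    exact hB
  rw [← habs]
  calc ∫ ω, |A ω - ∫ ω', A ω' ∂P| ∂P = ∫ a, |a - ∫ ω', A ω' ∂P| ∂(P.map A) := by
        rw [integral_map hAm (by fun_prop)]
    _ ≤ ∫ a, ∫ b, |a - b| ∂(P.map B) ∂(P.map A) := by
        refine integral_mono ((hidA.sub (integrable_const _)).abs) hint.integral_prod_left
          fun a => ?_
        have h1 : ∫ b, (a - b) ∂(P.map B) = a - ∫ ω', A ω' ∂P := by
          rw [integral_sub (integrable_const _) hidB, integral_const, probReal_univ,
            one_smul, integral_map hBm (by fun_prop), ← hid.integral_eq]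
        simp only
        rw [← h1]
        exact abs_integral_le_integral_abs
    _ = ∫ p, |p.1 - p.2| ∂((P.map A).prod (P.map B)) := (integral_prod _ hint).symm
    _ = ∫ ω, |A ω - B ω| ∂P := by
        rw [← hprod, integral_map (by fun_prop) (by fun_prop)]

/-- Truncation at level `t`: pointwise `Y ≤ t ^ (-ε) * Y ^ (1 + ε) + t`. -/
theorem setIntegral_le_of_integrable_rpow [IsProbabilityMeasure P] {Y : Ω → ℝ} {ε t : ℝ}
    (hε : 0 < ε) (ht : 0 < t) (h0 : ∀ ω, 0 ≤ Y ω) (hY : Integrable Y P)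
    (hYε : Integrable (fun ω => Y ω ^ (1 + ε)) P) {s : Set Ω} :
    ∫ ω in s, Y ω ∂P ≤ t ^ (-ε) * ∫ ω, Y ω ^ (1 + ε) ∂P + t * P.real s := by
  have hpt : ∀ ω, Y ω ≤ t ^ (-ε) * Y ω ^ (1 + ε) + t := by
    intro ω
    have h2 : 0 ≤ t ^ (-ε) * Y ω ^ (1 + ε) :=
      mul_nonneg (Real.rpow_nonneg ht.le _) (Real.rpow_nonneg (h0 ω) _)
    rcases le_total (Y ω) t with h | h
    · linarith
    · have hpos : 0 < Y ω := ht.trans_le h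
      rw [Real.rpow_add hpos, Real.rpow_one, Real.rpow_neg ht.le]
      have h3 : t ^ ε ≤ Y ω ^ ε := Real.rpow_le_rpow ht.le h hε.le
      have h4 : 1 ≤ (t ^ ε)⁻¹ * Y ω ^ ε := by
        rw [inv_mul_eq_div, one_le_div (Real.rpow_pos_of_pos ht _)]
        exact h3
      nlinarith
  calc ∫ ω in s, Y ω ∂P ≤ ∫ ω in s, (t ^ (-ε) * Y ω ^ (1 + ε) + t) ∂P :=
        integral_mono hY.integrableOn ((hYε.const_mul _).add (integrable_const t)).integrableOn hpt
    _ = t ^ (-ε) * ∫ ω in s, Y ω ^ (1 + ε) ∂P + t * P.real s := by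
        rw [integral_add (hYε.const_mul _).integrableOn (integrable_const t).integrableOn,
          integral_const_mul]
        simp [mul_comm]
    _ ≤ _ := by
        gcongr
        · exact ae_of_all _ fun ω => Real.rpow_nonneg (h0 ω) _
        · exact Measure.restrict_le_self

theorem integrable_of_integrable_rpow [IsProbabilityMeasure P] {Y : Ω → ℝ} {ε : ℝ}
    (hε : 0 < ε) (h0 : ∀ ω, 0 ≤ Y ω) (hm : Measurable Y)
    (hYε : Integrable (fun ω => Y ω ^ (1 + ε)) P) : Integrable Y P := by
  refine ((integrable_const (1 : ℝ)).add hYε).mono' hm.aestronglyMeasurable (ae_of_all _ fun ω => ?_)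
  rw [Real.norm_of_nonneg (h0 ω), Pi.add_apply]
  rcases le_total (Y ω) 1 with h | h
  · linarith [Real.rpow_nonneg (h0 ω) (1 + ε)]
  · have := Real.rpow_le_rpow_of_exponent_le h (show (1 : ℝ) ≤ 1 + ε by linarith)
    rw [Real.rpow_one] at this
    linarith

theorem isTightMeasureSet_of_integral_abs_le {ι : Type*} [IsProbabilityMeasure P] {Y : ι → Ω → ℝ}
    (hY : ∀ i, Integrable (Y i) P) (hm : ∀ i, Measurable (Y i)) {C : ℝ}
    (hC : ∀ i, ∫ ω, |Y i ω| ∂P ≤ C) :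
    IsTightMeasureSet {ν : Measure ℝ | ∃ i, ν = P.map (Y i)} := by
  rw [isTightMeasureSet_iff_exists_isCompact_measure_compl_le]
  intro ε hε
  rcases eq_or_ne ε ⊤ with rfl | hε'
  · exact ⟨∅, isCompact_empty, fun _ _ => le_top⟩
  have hε0 : 0 < ε.toReal := ENNReal.toReal_pos hε.ne' hε'
  set r : ℝ := (|C| + 1) / ε.toReal with hr
  have hr0 : 0 < r := by positivity
  refine ⟨Metric.closedBall 0 r, isCompact_closedBall _ _, ?_⟩
  rintro _ ⟨i, rfl⟩
  rw [Measure.map_apply (hm i) Metric.isClosed_closedBall.measurableSet.compl]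
  have h1 : r * P.real {ω | r ≤ |Y i ω|} ≤ ∫ ω, |Y i ω| ∂P :=
    mul_meas_ge_le_integral_of_nonneg (ae_of_all _ fun _ => abs_nonneg _) (hY i).abs r
  have h2 : P.real {ω | r ≤ |Y i ω|} ≤ ε.toReal := by
    have h3 : r * P.real {ω | r ≤ |Y i ω|} ≤ r * ε.toReal := by
      rw [hr, div_mul_cancel₀ _ hε0.ne', ← hr]
      linarith [hC i, le_abs_self C]
    exact le_of_mul_le_mul_left h3 hr0
  calc P (Y i ⁻¹' (Metric.closedBall 0 r)ᶜ) ≤ P {ω | r ≤ |Y i ω|} := by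
        refine measure_mono fun ω hω => ?_
        simp only [Set.mem_preimage, Set.mem_compl_iff, mem_closedBall_zero_iff, Real.norm_eq_abs,
          not_le] at hω
        exact hω.le
    _ ≤ ε := by
        rw [← ENNReal.toReal_le_toReal (measure_ne_top _ _) hε']
        exact h2

end Probability

/-! ### Comparison of `D(n)` with its two one-sided versions. -/

section Main

variable {V Ω : Type*} [MeasurableSpace Ω] {P : Measure Ω}
  {T : SimpleGraph V} {ρ : V} {X : (prodZ T).edgeSet → Ω → ℝ}

/-- The part of `T × ℤ` that lies over the vertices of `T` closer to `u` than to `w`. -/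
def sideZ (T : SimpleGraph V) (u w : V) : Set (V × ℤ) :=
  {v | T.dist u v.1 < T.dist w v.1}

/-- The distance `D(n)` over the paths that stay closer to `u` than to `w`. -/
noncomputable def sideTime (X : (prodZ T).edgeSet → Ω → ℝ) (ρ u w : V) (n : ℕ) (ω : Ω) : ℝ :=
  restrictedTime (fun e => X e ω) (sideZ T u w) (ρ, (0 : ℤ)) (ρ, (n : ℤ))

theorem measurable_verticalTime [Countable V] (hX : IsIIDWeights X P) (n : ℕ) :
    Measurable (verticalTime X ρ n) :=
  measurable_passageTime hX.measurable _ _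

theorem measurable_sideTime [Countable V] (hX : IsIIDWeights X P) (u w : V) (n : ℕ) :
    Measurable (sideTime X ρ u w n) :=
  measurable_restrictedTime (fun e _ => hX.measurable e) _ _

theorem integrable_verticalTime [Countable V] (hX : IsIIDWeights X P)
    (hint : ∀ e, Integrable (X e) P) (n : ℕ) : Integrable (verticalTime X ρ n) P := by
  obtain ⟨γ, -, -⟩ := exists_vertical_walk T ρ n
  refine (integrable_pathWeight hint γ).mono' (measurable_verticalTime hX n).aestronglyMeasurable
    (ae_of_all _ fun ω => ?_)
  have h0 : 0 ≤ verticalTime X ρ n ω := passageTime_nonneg (fun e => hX.nonneg e ω) _ _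
  rw [Real.norm_of_nonneg h0]
  exact passageTime_le (fun e => hX.nonneg e ω) γ

theorem exists_edge_sideTime [IsProbabilityMeasure P] [T.LocallyFinite] (hT : T.IsTree) {d : ℕ} (hd : 3 ≤ d)
    (hreg : T.IsRegularOfDegree d) (hX : IsIIDWeights X P) {n : ℕ} {N : ℝ} (hN : 0 ≤ N)
    (γ : Ω → (prodZ T).Walk (ρ, (0 : ℤ)) (ρ, (n : ℤ)))
    (hγ : ∀ᵐ ω ∂P, IsMinimizing (fun e => X e ω) (γ ω))
    (hlen : ∫⁻ ω, ((γ ω).length : ℝ≥0∞) ∂P ≤ ENNReal.ofReal N) (l : ℕ) :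
    ∃ u w, T.Adj u w ∧ T.dist ρ u = l ∧ T.dist ρ w = l + 1 ∧
      P.real {ω | verticalTime X ρ n ω < sideTime X ρ u w n ω} ≤ (N + 1) / 2 ^ (l + 1) := by
  classical
  have : Countable V := hT.connected.countable_of_locallyFinite
  obtain ⟨S, hcard, hS⟩ := hT.exists_finset_dist_eq hd hreg ρ (l + 1)
  have hu : ∀ w, ∃ u, w ∈ S → T.Adj u w ∧ T.dist ρ u = l := by
    intro w
    by_cases hw : w ∈ S
    · have hne : w ≠ ρ := by
        rintro rfl
        simpa using hS _ hw
      obtain ⟨u, h1, h2⟩ := hT.connected.exists_adj_dist_eq_add_one hne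
      rw [hS w hw] at h2
      exact ⟨u, fun _ => ⟨h1, by omega⟩⟩
    · exact ⟨w, fun h => absurd h hw⟩
  choose u hu using hu
  let Bad : V → Set Ω := fun w => {ω | verticalTime X ρ n ω < sideTime X ρ (u w) w n ω}
  have hBad : ∀ w, MeasurableSet (Bad w) := fun w =>
    measurableSet_lt (measurable_verticalTime hX n) (measurable_sideTime hX _ _ n)
  have hcount : ∀ᵐ ω ∂P, ∑ w ∈ S, (Bad w).indicator (1 : Ω → ℝ≥0∞) ω ≤ (γ ω).length + 1 := by
    filter_upwards [hγ] with ω hω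
    -- A minimizer missing the fibre over `w` stays on the side of `u w`, which rules out `Bad w`.
    -- So a walk with `k` edges allows at most `k + 1` bad `w`.
    have hsub : (S.filter fun w => ω ∈ Bad w) ⊆ ((γ ω).support.map Prod.fst).toFinset := by
      intro w hw
      rw [Finset.mem_filter] at hw
      by_contra hnot
      have hmiss : ∀ v ∈ (γ ω).support, v.1 ≠ w := by
        rintro v hv rfl
        exact hnot (by simpa using ⟨v.2, hv⟩)
      have hside : ∀ v ∈ (γ ω).support, v ∈ sideZ T (u w) w := by
        refine hT.walk_mem_side (hu w hw.1).1 (γ ω) ?_ hmiss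
        simp only
        rw [T.dist_comm, (hu w hw.1).2, T.dist_comm, hS w hw.1]
        omega
      have h1 := restrictedTime_le (fun e => hX.nonneg e ω) (γ ω) hside
      have h2 : pathWeight (fun e => X e ω) (γ ω) ≤ verticalTime X ρ n ω := by
        have : Nonempty ((prodZ T).Walk (ρ, (0 : ℤ)) (ρ, (n : ℤ))) := ⟨γ ω⟩
        exact le_ciInf hω
      exact absurd hw.2 (not_lt.2 (h1.trans h2))
    have hle : (S.filter fun w => ω ∈ Bad w).card ≤ (γ ω).length + 1 :=
      (Finset.card_le_card hsub).trans ((List.toFinset_card_le _).trans (by simp))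
    calc ∑ w ∈ S, (Bad w).indicator (1 : Ω → ℝ≥0∞) ω
        = ((S.filter fun w => ω ∈ Bad w).card : ℝ≥0∞) := by
          simp [Set.indicator_apply]
      _ ≤ (γ ω).length + 1 := by exact_mod_cast hle
  have hsum : ∑ w ∈ S, P (Bad w) ≤ ENNReal.ofReal (N + 1) := by
    calc ∑ w ∈ S, P (Bad w) = ∫⁻ ω, ∑ w ∈ S, (Bad w).indicator (1 : Ω → ℝ≥0∞) ω ∂P := by
          rw [lintegral_finsetSum _ fun w _ => measurable_one.indicator (hBad w)]
          simp_rw [lintegral_indicator_one (hBad _)]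
      _ ≤ ∫⁻ ω, ((γ ω).length + 1 : ℝ≥0∞) ∂P := lintegral_mono_ae hcount
      _ = ∫⁻ ω, ((γ ω).length : ℝ≥0∞) ∂P + 1 := by
          rw [lintegral_add_right _ measurable_const]; simp
      _ ≤ ENNReal.ofReal N + 1 := by gcongr
      _ = ENNReal.ofReal (N + 1) := by rw [ENNReal.ofReal_add hN zero_le_one, ENNReal.ofReal_one]
  have hsum' : ∑ w ∈ S, P.real (Bad w) ≤ N + 1 := by
    simp only [Measure.real]
    rw [← ENNReal.toReal_sum fun w _ => measure_ne_top _ _]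
    exact ENNReal.toReal_le_of_le_ofReal (by linarith) hsum
  have hcard' : (2 : ℝ) ^ (l + 1) ≤ S.card := by exact_mod_cast hcard
  have hne : S.Nonempty := Finset.card_pos.1 (lt_of_lt_of_le (by positivity) hcard)
  obtain ⟨w, hw, hle⟩ := Finset.exists_le_of_sum_le hne
    (f := fun w => P.real (Bad w)) (g := fun _ => (N + 1) / 2 ^ (l + 1)) (by
      refine hsum'.trans ?_
      rw [Finset.sum_const, nsmul_eq_mul, mul_div_assoc', le_div_iff₀ (by positivity), mul_comm]
      gcongr)
  exact ⟨u w, w, (hu w hw).1, (hu w hw).2, hS w hw, hle⟩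

theorem integral_abs_verticalTime_sub_le [IsProbabilityMeasure P] [T.LocallyFinite] (hT : T.IsTree) {d : ℕ} (hd : 3 ≤ d)
    (hreg : T.IsRegularOfDegree d) (hX : IsIIDWeights X P) {n : ℕ} {N : ℝ} (hN : 0 ≤ N)
    (γ : Ω → (prodZ T).Walk (ρ, (0 : ℤ)) (ρ, (n : ℤ)))
    (hγ : ∀ᵐ ω ∂P, IsMinimizing (fun e => X e ω) (γ ω))
    (hlen : ∫⁻ ω, ((γ ω).length : ℝ≥0∞) ∂P ≤ ENNReal.ofReal N)
    (hint : ∀ e, Integrable (X e) P) {m : ℝ} (hm : ∀ e, ∫ ω, X e ω ∂P ≤ m) {a b : ℝ}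
    (hb : 0 ≤ b) (hab : ∀ e s, ∫ ω in s, X e ω ∂P ≤ a + b * P.real s) (l : ℕ) :
    ∫ ω, |verticalTime X ρ n ω - ∫ ω', verticalTime X ρ n ω' ∂P| ∂P ≤
      4 * (n * (a + b * ((N + 1) / 2 ^ (l + 1)))) + 4 * ((2 * l + 1) * m) := by
  have : Countable V := hT.connected.countable_of_locallyFinite
  obtain ⟨u, w, huw, hu, hw, hP⟩ := exists_edge_sideTime hT hd hreg hX hN γ hγ hlen l
  obtain ⟨φ, hφu, hφw⟩ := hT.exists_iso_swap hreg huw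
  have h0 : ∀ ω e, 0 ≤ X e ω := fun ω e => hX.nonneg e ω
  let Φ : prodZ T →g prodZ T := φ.prodZ.toHom
  have hΦ : Function.Injective Φ.mapEdgeSet :=
    SimpleGraph.Hom.mapEdgeSet.injective _ φ.prodZ.injective
  let D : Ω → ℝ := verticalTime X ρ n
  let A : Ω → ℝ := sideTime X ρ u w n
  -- Pulling the weights back along the reflection makes `B` a passage time over the half of `w`,
  -- between the mirror images of the end points.
  let B : Ω → ℝ := sideTime (fun e => X (Φ.mapEdgeSet e)) ρ u w n
  obtain ⟨z, hzlen, hz⟩ := exists_vertical_walk T ρ n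
  have hρ : T.dist u ρ < T.dist w ρ := by rw [T.dist_comm, hu, T.dist_comm, hw]; omega
  have hzside : ∀ v ∈ z.support, v ∈ sideZ T u w := by
    intro v hv
    simp only [sideZ, Set.mem_ofPred_eq]
    rwa [hz v hv]
  have hDm : Measurable D := measurable_verticalTime hX n
  have hD : Integrable D P := integrable_verticalTime hX hint n
  have hAm : Measurable A := measurable_sideTime hX u w n
  have hAZ : ∀ ω, A ω ≤ pathWeight (fun e => X e ω) z := fun ω =>
    restrictedTime_le (h0 ω) z hzside
  have hA : Integrable A P := by
    refine (integrable_pathWeight hint z).mono' hAm.aestronglyMeasurable (ae_of_all _ fun ω => ?_)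
    have h1 : 0 ≤ A ω := restrictedTime_nonneg (h0 ω) _ _ _
    rw [Real.norm_of_nonneg h1]
    exact hAZ ω
  have hDA : ∀ ω, D ω ≤ A ω := fun ω => passageTime_le_restrictedTime (h0 ω) z hzside
  have hid : IdentDistrib A B P P :=
    (identDistrib_precomp_of_iIndepFun hX.indep hX.measurable hX.identDistrib hΦ).comp
      (u := fun x => restrictedTime x (sideZ T u w) (ρ, (0 : ℤ)) (ρ, (n : ℤ)))
      (measurable_restrictedTime (fun e _ => measurable_pi_apply e) _ _)
  have hB : Integrable B P := hid.integrable_iff.1 hA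
  have hind : IndepFun A B P := by
    refine hX.indep.indepFun_of_measurable_iSup hX.measurable
      (S := {e | ∀ v ∈ e.1, v ∈ sideZ T u w}) (S' := {e | ∀ v ∈ e.1, v ∉ sideZ T u w}) ?_ ?_ ?_
    · rw [Set.disjoint_left]
      rintro ⟨e, he⟩ h1 h2
      induction e with
      | _ x y => exact h2 x (by simp) (h1 x (by simp))
    · refine measurable_restrictedTime (fun e he => ?_) _ _
      exact (comap_measurable (X e)).mono (le_iSup₂_of_le e he le_rfl) le_rfl
    · refine measurable_restrictedTime (fun e he => ?_) _ _
      refine (comap_measurable (X (Φ.mapEdgeSet e))).mono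
        (le_iSup₂_of_le (Φ.mapEdgeSet e) ?_ le_rfl) le_rfl
      intro v hv hvs
      obtain ⟨v', hv', rfl⟩ := Sym2.mem_map.1 hv
      have h1 : T.dist u v'.1 < T.dist w v'.1 := he v' hv'
      have h2 : T.dist u (φ v'.1) < T.dist w (φ v'.1) := hvs
      have h3 := φ.dist_eq u v'.1
      have h4 := φ.dist_eq w v'.1
      rw [hφu] at h3
      rw [hφw] at h4
      omega
  obtain ⟨α, hα⟩ := hT.connected.exists_horizontal_walk ρ (φ ρ) 0
  obtain ⟨β, hβ⟩ := hT.connected.exists_horizontal_walk (φ ρ) ρ n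
  -- Go through `w`: `l + 1` steps from `ρ`, then `l` more to `φ ρ`, because `w = φ u`.
  have hdist : T.dist ρ (φ ρ) ≤ 2 * l + 1 := by
    have h1 := hT.connected.dist_triangle (u := ρ) (v := w) (w := φ ρ)
    have h2 : T.dist w (φ ρ) = l := by rw [← hφu, φ.dist_eq, T.dist_comm, hu]
    omega
  let h : Ω → ℝ := fun ω => pathWeight (fun e => X e ω) α + pathWeight (fun e => X e ω) β
  have hh : Integrable h P := (integrable_pathWeight hint α).add (integrable_pathWeight hint β)
  have hDB : ∀ ω, D ω ≤ B ω + h ω := fun ω =>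
    passageTime_le_restrictedTime_comp_add (h0 ω) Φ z hzside α β
  have hm0 : 0 ≤ m := (integral_nonneg (hX.nonneg ⟨s((u, 0), (w, 0)),
    SimpleGraph.boxProd_adj_left.2 huw⟩)).trans (hm _)
  have hhm : ∫ ω, h ω ∂P ≤ 2 * ((2 * l + 1) * m) := by
    have hw : ∀ {a b} (η : (prodZ T).Walk a b), η.length ≤ 2 * l + 1 →
        ∫ ω, pathWeight (fun e => X e ω) η ∂P ≤ (2 * l + 1) * m := by
      intro a b η hη
      have h1 := setIntegral_pathWeight_le hint (s := Set.univ) (c := m) (by simpa using hm) η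
      rw [setIntegral_univ] at h1
      refine h1.trans ?_
      gcongr
      exact_mod_cast hη
    simp only [h]
    rw [integral_add (integrable_pathWeight hint α) (integrable_pathWeight hint β)]
    have h1 := hw α (by rw [hα]; exact hdist)
    have h2 := hw β (by rw [hβ, T.dist_comm]; exact hdist)
    linarith
  set R : ℝ := n * (a + b * ((N + 1) / 2 ^ (l + 1))) with hR
  -- Where `D < A`, the gap is at most the weight of the vertical walk `z`, which has `n` edges.
  have hAD : ∫ ω, (A ω - D ω) ∂P ≤ R := by
    have hs : MeasurableSet {ω | D ω < A ω} := measurableSet_lt hDm hAm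
    calc ∫ ω, (A ω - D ω) ∂P
        ≤ ∫ ω, {ω | D ω < A ω}.indicator (fun ω => pathWeight (fun e => X e ω) z) ω ∂P := by
          refine integral_mono (hA.sub hD) ((integrable_pathWeight hint z).indicator hs) fun ω => ?_
          by_cases hω : ω ∈ {ω | D ω < A ω}
          · rw [Set.indicator_of_mem hω]
            have := passageTime_nonneg (h0 ω) (ρ, (0 : ℤ)) (ρ, (n : ℤ))
            exact (sub_le_self _ this).trans (hAZ ω)
          · rw [Set.indicator_of_notMem hω]
            simp only [Set.mem_ofPred_eq, not_lt] at hω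
            simpa using hω
      _ = ∫ ω in {ω | D ω < A ω}, pathWeight (fun e => X e ω) z ∂P := integral_indicator hs
      _ ≤ z.length * (a + b * P.real {ω | D ω < A ω}) :=
          setIntegral_pathWeight_le hint (fun e => hab e _) z
      _ ≤ R := by
          rw [hzlen, hR]
          gcongr
  rw [integral_sub hA hD] at hAD
  have hmin : ∫ ω, D ω ∂P ≤ ∫ ω, min (A ω) (B ω) ∂P + 2 * ((2 * l + 1) * m) := by
    have hmi : Integrable (fun ω => min (A ω) (B ω)) P := hA.inf hB
    calc ∫ ω, D ω ∂P ≤ ∫ ω, (min (A ω) (B ω) + h ω) ∂P := by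
          refine integral_mono hD (hmi.add hh) fun ω => ?_
          have h1 : 0 ≤ h ω := add_nonneg (pathWeight_nonneg (h0 ω) _) (pathWeight_nonneg (h0 ω) _)
          rw [← sub_le_iff_le_add]
          exact le_min (by linarith [hDA ω]) (by linarith [hDB ω])
      _ ≤ _ := by rw [integral_add hmi hh]; linarith
  have hfluct := integral_abs_sub_integral_le_of_indepFun hA hind hid
  have habs : Integrable (fun ω => |A ω - ∫ ω', A ω' ∂P|) P := (hA.sub (integrable_const _)).abs
  have hsub : Integrable (fun ω => A ω - D ω) P := hA.sub hD
  have hED : ∫ ω, D ω ∂P ≤ ∫ ω, A ω ∂P := integral_mono hD hA hDA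
  -- Triangle inequality through `A`. The gap `E A - E D ≤ R` enters twice here and twice more
  -- through `hfluct`, whence `4 * R`.
  calc ∫ ω, |D ω - ∫ ω', D ω' ∂P| ∂P
      ≤ ∫ ω, ((A ω - D ω) + |A ω - ∫ ω', A ω' ∂P| + (∫ ω', A ω' ∂P - ∫ ω', D ω' ∂P)) ∂P := by
        refine integral_mono (hD.sub (integrable_const _)).abs
          ((hsub.add habs).add (integrable_const _)) fun ω => ?_
        simp only
        have h1 := hDA ω
        have h2 := le_abs_self (A ω - ∫ ω', A ω' ∂P)
        have h3 := neg_abs_le (A ω - ∫ ω', A ω' ∂P)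
        rw [abs_le]
        constructor <;> linarith
    _ = (∫ ω, A ω ∂P - ∫ ω, D ω ∂P) + ∫ ω, |A ω - ∫ ω', A ω' ∂P| ∂P +
        (∫ ω', A ω' ∂P - ∫ ω', D ω' ∂P) := by
        have hsum : Integrable (fun ω => A ω - D ω + |A ω - ∫ ω', A ω' ∂P|) P := hsub.add habs
        rw [integral_add hsum (integrable_const _), integral_add hsub habs, integral_sub hA hD]
        simp
    _ ≤ 4 * R + 4 * ((2 * l + 1) * m) := by linarith

end Main

/-! ### Choice of the depth `l`, and conclusion. -/

theorem exists_integral_abs_verticalTime_sub_le_log {V Ω : Type*} [MeasurableSpace Ω]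
    {P : Measure Ω} [IsProbabilityMeasure P] {d : ℕ} (hd : 3 ≤ d) {T : SimpleGraph V}
    [T.LocallyFinite] (hT : T.IsTree) (hreg : T.IsRegularOfDegree d) {ρ : V}
    {X : (prodZ T).edgeSet → Ω → ℝ} (hX : IsIIDWeights X P) (hH : HypothesisH X ρ P) :
    ∃ C : ℝ, ∀ n : ℕ, 2 ≤ n →
      ∫ ω, |verticalTime X ρ n ω - ∫ ω', verticalTime X ρ n ω' ∂P| ∂P ≤ C * Real.log n := by
  obtain ⟨ε, hε, hXε⟩ := hH.moment
  obtain ⟨K, γ, hγ⟩ := hH.minimizer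
  have hint : ∀ e, Integrable (X e) P := fun e =>
    integrable_of_integrable_rpow hε (hX.nonneg e) (hX.measurable e) (hXε e)
  have hK : 0 < K := by
    have := ENNReal.ofReal_pos.1 (bot_le.trans_lt (hγ 1 le_rfl).2)
    simpa using this
  let e₀ : (prodZ T).edgeSet := ⟨s((ρ, 0), (ρ, 0 + 1)), SimpleGraph.boxProd_adj_right.2
    (SimpleGraph.hasse_adj.2 (Or.inl (Order.covBy_add_one (0 : ℤ))))⟩
  let m := ∫ ω, X e₀ ω ∂P
  let M := ∫ ω, X e₀ ω ^ (1 + ε) ∂P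
  have hm0 : 0 ≤ m := integral_nonneg (hX.nonneg e₀)
  have hM0 : 0 ≤ M := integral_nonneg fun ω => Real.rpow_nonneg (hX.nonneg e₀ ω) _
  have hm : ∀ e, ∫ ω, X e ω ∂P = m := fun e => (hX.identDistrib e e₀).integral_eq
  have hM : ∀ e, ∫ ω, X e ω ^ (1 + ε) ∂P = M := fun e =>
    ((hX.identDistrib e e₀).comp (u := fun x : ℝ => x ^ (1 + ε)) (by fun_prop)).integral_eq
  -- The exponents of `n`, `t` and `n ^ K` add up to `c`; a depth with `2 ^ l ≥ n ^ c` makes the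
  -- bad-event term bounded.
  set c : ℝ := 1 + 1 / ε + K with hc
  have hc0 : 0 < c := by positivity
  have hlog2 : 0 < Real.log 2 := Real.log_pos one_lt_two
  refine ⟨(4 * (M + (K + 1)) + 12 * m + 8 * c * m) / Real.log 2, fun n hn => ?_⟩
  have hn0 : (0 : ℝ) < n := by positivity
  have hn1 : (1 : ℝ) ≤ n := by exact_mod_cast (by omega : 1 ≤ n)
  have hlog : Real.log 2 ≤ Real.log n := Real.log_le_log two_pos (by exact_mod_cast hn)
  obtain ⟨h1, h2⟩ := hγ n (by omega)
  have hN : 0 ≤ K * (n : ℝ) ^ K := by positivity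
  -- This level gives `t ^ (-ε) = 1 / n`, so the tails of the `n` vertical edges contribute at most
  -- `M` in total.
  set t : ℝ := (n : ℝ) ^ (1 / ε) with ht
  have ht0 : 0 < t := by positivity
  have htε : t ^ (-ε) = (n : ℝ)⁻¹ := by
    rw [ht, ← Real.rpow_mul hn0.le, ← Real.rpow_neg_one]
    congr 1
    field_simp
  set l : ℕ := ⌈c * Real.log n / Real.log 2⌉₊ with hl
  have hl1 : (l : ℝ) ≤ c * Real.log n / Real.log 2 + 1 :=
    (Nat.ceil_lt_add_one (by positivity)).le
  have hpow : (n : ℝ) ^ c ≤ 2 ^ (l + 1) := by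
    have h3 : c * Real.log n ≤ l * Real.log 2 := by
      rw [← div_le_iff₀ hlog2]
      exact Nat.le_ceil _
    calc (n : ℝ) ^ c ≤ 2 ^ l := by
          rw [← Real.log_le_log_iff (by positivity) (by positivity), Real.log_rpow hn0,
            Real.log_pow]
          exact h3
      _ ≤ 2 ^ (l + 1) := pow_le_pow_right₀ one_le_two (Nat.le_succ l)
  have hmain := integral_abs_verticalTime_sub_le hT hd hreg hX hN (γ n) h1 h2.le hint
    (fun e => (hm e).le) ht0.le (a := (n : ℝ)⁻¹ * M) (fun e s => by
      rw [← htε, ← hM e]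
      exact setIntegral_le_of_integrable_rpow hε ht0 (hX.nonneg e) (hint e) (hXε e)) l
  have hR : n * ((n : ℝ)⁻¹ * M + t * ((K * (n : ℝ) ^ K + 1) / 2 ^ (l + 1))) ≤ M + (K + 1) := by
    have h4 : (1 : ℝ) ≤ (n : ℝ) ^ K := Real.one_le_rpow hn1 hK.le
    have h5 : (n : ℝ) ^ c = n * t * (n : ℝ) ^ K := by
      rw [hc, Real.rpow_add hn0, Real.rpow_add hn0, Real.rpow_one]
    have h6 : n * (t * ((K * (n : ℝ) ^ K + 1) / 2 ^ (l + 1))) ≤ K + 1 := by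
      rw [mul_div_assoc', mul_div_assoc', div_le_iff₀ (by positivity)]
      calc n * (t * (K * (n : ℝ) ^ K + 1)) ≤ n * (t * (K * (n : ℝ) ^ K + (n : ℝ) ^ K)) := by gcongr
        _ = (K + 1) * (n : ℝ) ^ c := by rw [h5]; ring
        _ ≤ (K + 1) * 2 ^ (l + 1) := by gcongr
    rw [mul_add, mul_inv_cancel_left₀ hn0.ne']
    linarith
  -- As `n ≥ 2`, additive constants are absorbed into the multiple of `log n`.
  have hratio : 1 ≤ Real.log n / Real.log 2 := (one_le_div hlog2).2 hlog
  calc _ ≤ _ := hmain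
    _ ≤ 4 * (M + (K + 1)) + 4 * ((2 * (c * Real.log n / Real.log 2 + 1) + 1) * m) := by gcongr
    _ = (4 * (M + (K + 1)) + 12 * m) * 1 + 8 * c * m * (Real.log n / Real.log 2) := by ring
    _ ≤ (4 * (M + (K + 1)) + 12 * m) * (Real.log n / Real.log 2) +
        8 * c * m * (Real.log n / Real.log 2) := by gcongr
    _ = _ := by ring

theorem mainTheorem1 {V Ω : Type*} [MeasurableSpace Ω] (P : Measure Ω) [IsProbabilityMeasure P]
    (d : ℕ) (hd : 3 ≤ d) (T : SimpleGraph V) [T.LocallyFinite] (hT : T.IsTree)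
    (hreg : T.IsRegularOfDegree d) (ρ : V)
    (X : (prodZ T).edgeSet → Ω → ℝ) (hX : IsIIDWeights X P) (hH : HypothesisH X ρ P) :
    (∀ n : ℕ, Measurable (verticalTime X ρ n) ∧ Integrable (verticalTime X ρ n) P) ∧
    IsTightMeasureSet {ν : Measure ℝ | ∃ n : ℕ, 2 ≤ n ∧
      ν = P.map (fun ω => (verticalTime X ρ n ω - ∫ ω', verticalTime X ρ n ω' ∂P) /
        Real.log n)} ∧
    ∃ C : ℝ, ∀ n : ℕ, 2 ≤ n →
      ∫ ω, |verticalTime X ρ n ω - ∫ ω', verticalTime X ρ n ω' ∂P| ∂P ≤ C * Real.log n := by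
  have : Countable V := hT.connected.countable_of_locallyFinite
  obtain ⟨ε, hε, hXε⟩ := hH.moment
  have hm : ∀ n, Measurable (verticalTime X ρ n) := measurable_verticalTime hX
  have hi : ∀ n, Integrable (verticalTime X ρ n) P := integrable_verticalTime hX fun e =>
    integrable_of_integrable_rpow hε (hX.nonneg e) (hX.measurable e) (hXε e)
  obtain ⟨C, hC⟩ := exists_integral_abs_verticalTime_sub_le_log hd hT hreg hX hH
  refine ⟨fun n => ⟨hm n, hi n⟩, ?_, C, hC⟩
  have htight := isTightMeasureSet_of_integral_abs_le (P := P) (ι := {n : ℕ // 2 ≤ n})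
    (Y := fun n ω => (verticalTime X ρ n ω - ∫ ω', verticalTime X ρ n ω' ∂P) / Real.log n.1)
    (fun n => ((hi n).sub (integrable_const _)).div_const _)
    (fun n => ((hm n).sub_const _).div_const _) (C := C) (fun n => ?_)
  · simpa only [Subtype.exists, exists_prop] using htight
  · have hlog : 0 < Real.log n.1 := Real.log_pos (by exact_mod_cast n.2)
    simp_rw [abs_div, abs_of_pos hlog]
    rw [integral_div, div_le_iff₀ hlog]
    exact hC n n.2
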